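/- Let $k$ be a field of characteristic zero and let $\mathfrak g$ be a (possibly infinite-dimensional) Lie algebra over $k$, with symmetric algebra $S=S\mathfrak g=\bigoplus_{n\ge 0}S^n$ and universal enveloping algebra $U=U\mathfrak g$. Let $e:S\to U$ be the symmetrization map, the $k$-linear map with $$e(g_1\cdots g_n)=\frac1{n!}\sum_{\sigma\in\mathfrak S_n}g_{\sigma(1)}\cdots g_{\sigma(n)}\qquad(n\ge 0,\ g_1,\dots,g_n\in\mathfrak g).$$ Then $e$ is bijective (Poincaré–Birkhoff–Witt). Let $B:S\times S\to S$ be the bilinear map $B(x,y)=e^{-1}(e(x)e(y))$, and for $p\ge 0$ let $B_p:S\times S\to S$ be its homogeneous component of degree $-p$, that is, the bilinear map that sends $(x,y)\in S^n\times S^m$ to the component of $B(x,y)$ in $S^{n+m-p}$ (to $0$ if $n+m<p$). A $k$-linear endomorphism $F$ of a commutative $k$-algebra $A$ is called a differential operator of order $\le p$ if $$\sum_{I\subseteq\{0,1,\dots,p\}}(-1)^{\#I}\Big(\prod_{i\notin I}a_i\Big)F\Big(\Big(\prod_{i\in I}a_i\Big)b\Big)=0\qquad\text{for all }a_0,\dots,a_p,b\in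 A,$$ and a bilinear map $A\times A\to A$ is called a bidifferential operator of order $\le p$ if it is a differential operator of order $\le p$ in each of its arguments when the other one is fixed. Theorem. For every $p\ge 1$ and every $a\in S$, the maps $B_p(a,\cdot)$ and $B_p(\cdot,a)$ from $S$ to $S$ are differential operators of order $\le p$. Hence $B_p$ is a bidifferential operator of order $\le p$. -/

import Mathlib

noncomputable section

namespace PBW

open scoped DirectSum

/-! ### The grading of the symmetric algebra -/

section Grading

variable (k V : Type*) [CommRing k] [AddCommGroup V] [Module k V]

/-- The homogeneous component `Sⁿ V` of the symmetric algebra: the span of the products of `n`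
elements of `V`. -/
def symPow (n : ℕ) : Submodule k (SymmetricAlgebra k V) :=
  LinearMap.range (SymmetricAlgebra.ι k V) ^ n

instance : SetLike.GradedMonoid (symPow k V) :=
  inferInstanceAs (SetLike.GradedMonoid (LinearMap.range (SymmetricAlgebra.ι k V) ^ ·))

theorem ι_mem_symPow (v : V) : SymmetricAlgebra.ι k V v ∈ symPow k V 1 := by
  simp [symPow]

/-- The inclusion of `V` in degree one of the direct sum of the `Sⁿ V`. -/
def gradedι : V →ₗ[k] ⨁ n, symPow k V n :=
  DirectSum.lof k ℕ (fun n => symPow k V n) 1 ∘ₗ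
    (SymmetricAlgebra.ι k V).codRestrict _ (ι_mem_symPow k V)

theorem gradedι_apply (v : V) :
    gradedι k V v = DirectSum.of (fun n => symPow k V n) 1
      ⟨SymmetricAlgebra.ι k V v, ι_mem_symPow k V v⟩ := rfl

/-- The symmetric algebra is graded, `S V = ⨁ n, Sⁿ V`. -/
instance symGraded : GradedAlgebra (symPow k V) :=
  GradedAlgebra.ofAlgHom _ (SymmetricAlgebra.lift (gradedι k V))
    (by
      apply SymmetricAlgebra.algHom_ext
      ext v
      simp [gradedι_apply])
    (fun n x => by
      obtain ⟨x, hx⟩ := x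
      change SymmetricAlgebra.lift (gradedι k V) x = _
      unfold symPow at hx
      induction hx using Submodule.pow_induction_on_left' with
      | algebraMap r =>
        rw [AlgHom.commutes, DirectSum.algebraMap_apply]; rfl
      | add x y i hx hy ihx ihy =>
        rw [map_add, ihx, ihy, ← map_add]
        rfl
      | mem_mul m hm i x hx ih =>
        obtain ⟨v, rfl⟩ := hm
        rw [map_mul, ih, SymmetricAlgebra.lift_ι_apply, gradedι_apply, DirectSum.of_mul_of]
        exact DirectSum.of_eq_of_gradedMonoid_eq (Sigma.subtype_ext (add_comm _ _) rfl))

end Grading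

/-! ### The symmetrization map -/

section Symmetrization

attribute [local instance] LieRing.ofAssociativeRing

variable (k g : Type*) [Field k] [LieRing g] [LieAlgebra k g]

/-- `(x₁, …, xₙ) ↦ (1 / n!) ∑_σ x_{σ(1)} ⋯ x_{σ(n)}`, with values in the enveloping algebra. -/
def symMultilinear (n : ℕ) :
    MultilinearMap k (fun _ : Fin n => g) (UniversalEnvelopingAlgebra k g) :=
  (n.factorial : k)⁻¹ • ∑ σ : Equiv.Perm (Fin n),
    ((MultilinearMap.mkPiAlgebraFin k n (UniversalEnvelopingAlgebra k g)).compLinearMap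
      (fun _ => LieHom.toLinearMap (UniversalEnvelopingAlgebra.ι k))).domDomCongr σ

theorem symMultilinear_apply (n : ℕ) (x : Fin n → g) :
    symMultilinear k g n x = (n.factorial : k)⁻¹ • ∑ σ : Equiv.Perm (Fin n),
      (List.ofFn fun i => UniversalEnvelopingAlgebra.ι k (x (σ i))).prod := by
  simp [symMultilinear]

theorem symMultilinear_perm (n : ℕ) (x : Fin n → g) (τ : Equiv.Perm (Fin n)) :
    symMultilinear k g n (x ∘ τ) = symMultilinear k g n x := by
  simp only [symMultilinear_apply, Function.comp_apply]
  congr 1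
  exact Fintype.sum_equiv (Equiv.mulLeft τ) _ _ (fun σ => by simp)

/-- The symmetrization map on the tensor algebra. -/
def symTensor : TensorAlgebra k g →ₗ[k] UniversalEnvelopingAlgebra k g :=
  DirectSum.toModule k ℕ _ (fun n => PiTensorProduct.lift (symMultilinear k g n)) ∘ₗ
    (TensorAlgebra.equivDirectSum (R := k) (M := g)).toLinearMap

theorem symTensor_tprod (n : ℕ) (x : Fin n → g) :
    symTensor k g (TensorAlgebra.tprod k g n x) = symMultilinear k g n x := by
  have h : (TensorAlgebra.equivDirectSum (R := k) (M := g)) (TensorAlgebra.tprod k g n x) =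
      DirectSum.lof k ℕ (fun n => TensorPower k n g) n (PiTensorProduct.tprod k x) :=
    TensorAlgebra.toDirectSum_tensorPower_tprod x
  simp only [symTensor, LinearMap.comp_apply, AlgEquiv.toLinearMap_apply, h,
    DirectSum.toModule_lof]
  simp

/-- The tensor algebra is spanned by the products of lists of elements of `g`. -/
theorem tensor_span :
    Submodule.span k (Set.range fun l : List g => (l.map (TensorAlgebra.ι k)).prod) = ⊤ := by
  rw [eq_top_iff]
  rintro t -
  induction t using TensorAlgebra.induction with
  | algebraMap r =>
    rw [Algebra.algebraMap_eq_smul_one]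
    exact Submodule.smul_mem _ _ (Submodule.subset_span ⟨[], by simp⟩)
  | ι x => exact Submodule.subset_span ⟨[x], by simp⟩
  | add a b ha hb => exact Submodule.add_mem _ ha hb
  | mul a b ha hb =>
    have := Submodule.mul_mem_mul ha hb
    rw [Submodule.span_mul_span] at this
    refine Submodule.span_mono ?_ this
    rintro _ ⟨_, ⟨l, rfl⟩, _, ⟨m, rfl⟩, rfl⟩
    exact ⟨l ++ m, by simp⟩

theorem symTensor_swap_list (l m : List g) (x y : g) :
    symTensor k g ((l.map (TensorAlgebra.ι k)).prod * (TensorAlgebra.ι k x * TensorAlgebra.ι k y) *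
        (m.map (TensorAlgebra.ι k)).prod) =
      symTensor k g ((l.map (TensorAlgebra.ι k)).prod *
        (TensorAlgebra.ι k y * TensorAlgebra.ι k x) * (m.map (TensorAlgebra.ι k)).prod) := by
  set w : List g := l ++ x :: y :: m with hw
  have hl : l.length + 1 < w.length := by simp [hw]
  let τ : Equiv.Perm (Fin w.length) := Equiv.swap ⟨l.length, by omega⟩ ⟨l.length + 1, hl⟩
  have h₁ : (l.map (TensorAlgebra.ι k)).prod * (TensorAlgebra.ι k x * TensorAlgebra.ι k y) *
      (m.map (TensorAlgebra.ι k)).prod = TensorAlgebra.tprod k g _ w.get := by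
    have : List.ofFn (fun i => TensorAlgebra.ι k (w.get i)) = w.map (TensorAlgebra.ι k) := by
      apply List.ext_get <;> simp
    rw [TensorAlgebra.tprod_apply, this]
    simp [hw, mul_assoc]
  have h₂ : (l.map (TensorAlgebra.ι k)).prod * (TensorAlgebra.ι k y * TensorAlgebra.ι k x) *
      (m.map (TensorAlgebra.ι k)).prod = TensorAlgebra.tprod k g _ (w.get ∘ τ) := by
    have : List.ofFn (w.get ∘ τ) = l ++ y :: x :: m := by
      apply List.ext_getElem
      · simp [hw, add_assoc]
      · intro i hi hi'
        simp only [List.getElem_ofFn, Function.comp_apply, τ, Equiv.swap_apply_def]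
        grind
    have : List.ofFn (fun i => TensorAlgebra.ι k ((w.get ∘ τ) i)) =
        (l ++ y :: x :: m).map (TensorAlgebra.ι k) := by
      rw [← this, List.map_ofFn]
      rfl
    rw [TensorAlgebra.tprod_apply, this]
    simp [mul_assoc]
  rw [h₁, h₂, symTensor_tprod, symTensor_tprod, symMultilinear_perm]

theorem symTensor_swap (s t : TensorAlgebra k g) (x y : g) :
    symTensor k g (s * (TensorAlgebra.ι k x * TensorAlgebra.ι k y) * t) =
      symTensor k g (s * (TensorAlgebra.ι k y * TensorAlgebra.ι k x) * t) := by
  have hs : s ∈ Submodule.span k (Set.range fun l : List g => (l.map (TensorAlgebra.ι k)).prod) :=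
    tensor_span k g ▸ Submodule.mem_top
  have ht : t ∈ Submodule.span k (Set.range fun l : List g => (l.map (TensorAlgebra.ι k)).prod) :=
    tensor_span k g ▸ Submodule.mem_top
  induction hs using Submodule.span_induction with
  | zero => simp
  | add a b _ _ ha hb => simp only [add_mul, map_add, ha, hb]
  | smul r a _ ha => simp only [smul_mul_assoc, map_smul, ha]
  | mem a ha =>
    obtain ⟨l, rfl⟩ := ha
    induction ht using Submodule.span_induction with
    | zero => simp
    | add a b _ _ ha hb => simp only [mul_add, map_add, ha, hb]
    | smul r a _ ha => simp only [mul_smul_comm, map_smul, ha]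
    | mem a ha =>
      obtain ⟨m, rfl⟩ := ha
      exact symTensor_swap_list k g l m x y

/-- The largest ring congruence through which `symTensor` factors. -/
def symCon : RingCon (TensorAlgebra k g) where
  r a b := ∀ s t, symTensor k g (s * a * t) = symTensor k g (s * b * t)
  iseqv := ⟨fun _ _ _ => rfl, fun h s t => (h s t).symm, fun h h' s t => (h s t).trans (h' s t)⟩
  add' h h' s t := by simp only [mul_add, add_mul, map_add, h s t, h' s t]
  mul' {a b c d} h h' s t := by
    rw [show s * (a * c) * t = s * a * (c * t) by simp only [mul_assoc], h,
      show s * b * (c * t) = (s * b) * c * t by simp only [mul_assoc], h']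
    simp only [mul_assoc]

theorem symRingCon_le : TensorAlgebra.symRingCon k g ≤ symCon k g := by
  refine RingCon.ringConGen_le.2 fun a b h => ?_
  cases h with
  | mul_comm x y => exact fun s t => symTensor_swap k g s t x y

theorem symTensor_eq {a b : TensorAlgebra k g} (h : TensorAlgebra.symRingCon k g a b) :
    symTensor k g a = symTensor k g b := by
  simpa using symRingCon_le k g h 1 1

/-- The symmetrization map `e : S g → U g`; see `symmetrization_prod` for its values on
monomials. -/
def symmetrization : SymmetricAlgebra k g →ₗ[k] UniversalEnvelopingAlgebra k g where
  toFun := Quotient.lift (symTensor k g) (fun _ _ h => symTensor_eq k g h)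
  map_add' a b := by
    obtain ⟨a, rfl⟩ := SymmetricAlgebra.algHom_surjective k g a
    obtain ⟨b, rfl⟩ := SymmetricAlgebra.algHom_surjective k g b
    rw [← map_add]
    exact map_add (symTensor k g) a b
  map_smul' r a := by
    obtain ⟨a, rfl⟩ := SymmetricAlgebra.algHom_surjective k g a
    rw [← map_smul]
    exact map_smul (symTensor k g) r a

/-- `e(x₁ ⋯ xₙ) = (1 / n!) ∑_σ x_{σ(1)} ⋯ x_{σ(n)}`. -/
theorem symmetrization_prod (n : ℕ) (x : Fin n → g) :
    symmetrization k g (∏ i, SymmetricAlgebra.ι k g (x i)) =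
      (n.factorial : k)⁻¹ • ∑ σ : Equiv.Perm (Fin n),
        (List.ofFn fun i => UniversalEnvelopingAlgebra.ι k (x (σ i))).prod := by
  have h : ∏ i, SymmetricAlgebra.ι k g (x i) =
      SymmetricAlgebra.algHom k g (TensorAlgebra.tprod k g n x) := by
    rw [TensorAlgebra.tprod_apply, map_list_prod, List.map_ofFn, List.prod_ofFn]
    rfl
  rw [h, ← symMultilinear_apply, ← symTensor_tprod]
  rfl

/-- The inverse `e⁻¹ : U g → S g` of the symmetrization map (and `0` if `e` were not bijective). -/
def symmetrizationInv : UniversalEnvelopingAlgebra k g →ₗ[k] SymmetricAlgebra k g :=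
  open Classical in
  if h : Function.Bijective (symmetrization k g) then
    (LinearEquiv.ofBijective (symmetrization k g) h).symm.toLinearMap
  else 0

/-- The product `B(x, y) = e⁻¹(e(x) e(y))` on the symmetric algebra. -/
def starProduct :
    SymmetricAlgebra k g →ₗ[k] SymmetricAlgebra k g →ₗ[k] SymmetricAlgebra k g :=
  ((LinearMap.mul k (UniversalEnvelopingAlgebra k g)).compl₁₂
    (symmetrization k g) (symmetrization k g)).compr₂ (symmetrizationInv k g)

theorem starProduct_apply (x y : SymmetricAlgebra k g) :
    starProduct k g x y =
      symmetrizationInv k g (symmetrization k g x * symmetrization k g y) := rfl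

end Symmetrization

/-! ### Homogeneous components of a bilinear map -/

section Components

variable {k V : Type*} [CommRing k] [AddCommGroup V] [Module k V]

/-- The homogeneous component of degree `-p` of a bilinear map `B` on `S V`: the bilinear map that
sends `(x, y) ∈ Sⁿ V × Sᵐ V` to the component of degree `n + m - p` of `B(x, y)`, and to `0` if
`n + m < p`; see `component_apply`. -/
def component
    (B : SymmetricAlgebra k V →ₗ[k] SymmetricAlgebra k V →ₗ[k] SymmetricAlgebra k V) (p : ℕ) :
    SymmetricAlgebra k V →ₗ[k] SymmetricAlgebra k V →ₗ[k] SymmetricAlgebra k V :=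
  DirectSum.toModule k ℕ _ (fun n =>
    (DirectSum.toModule k ℕ _ (fun m =>
      (if p ≤ n + m then
        (B.compr₂ (GradedAlgebra.proj (symPow k V) (n + m - p))).domRestrict₁₂
          (symPow k V n) (symPow k V m)
      else 0).flip) ∘ₗ
      (DirectSum.decomposeLinearEquiv (symPow k V)).toLinearMap).flip) ∘ₗ
    (DirectSum.decomposeLinearEquiv (symPow k V)).toLinearMap

theorem component_apply
    (B : SymmetricAlgebra k V →ₗ[k] SymmetricAlgebra k V →ₗ[k] SymmetricAlgebra k V) (p : ℕ)
    {n m : ℕ} {x y : SymmetricAlgebra k V} (hx : x ∈ symPow k V n) (hy : y ∈ symPow k V m) :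
    component B p x y =
      if p ≤ n + m then GradedAlgebra.proj (symPow k V) (n + m - p) (B x y) else 0 := by
  lift x to symPow k V n using hx
  lift y to symPow k V m using hy
  simp only [component, LinearMap.comp_apply, LinearEquiv.coe_coe,
    DirectSum.decomposeLinearEquiv_apply_coe, DirectSum.toModule_lof, LinearMap.flip_apply]
  split_ifs
  · rfl
  · simp

end Components

/-- The component `B_p` of degree `-p` of the product `B(x, y) = e⁻¹(e(x) e(y))` on `S g`. -/
def starComponent (k g : Type*) [Field k] [LieRing g] [LieAlgebra k g] (p : ℕ) :
    SymmetricAlgebra k g →ₗ[k] SymmetricAlgebra k g →ₗ[k] SymmetricAlgebra k g :=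
  component (starProduct k g) p

/-! ### Differential operators -/

section DifferentialOperators

variable {k A : Type*} [CommRing k] [CommRing A] [Algebra k A]

/-- A `k`-linear endomorphism `F` of a commutative algebra is a differential operator of order
`≤ p` if its iterated commutator with the multiplications by any `p + 1` elements vanishes, that
is `∑_{S ⊆ {0, …, p}} (-1)^{#S} a_{Sᶜ} F(a_S b) = 0`. -/
def IsDifferentialOperator (p : ℕ) (F : A →ₗ[k] A) : Prop :=
  ∀ (a : Fin (p + 1) → A) (b : A),
    ∑ S : Finset (Fin (p + 1)), (-1) ^ S.card * (∏ i ∈ Sᶜ, a i) * F ((∏ i ∈ S, a i) * b) = 0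

/-- A bilinear map is a bidifferential operator of order `≤ p` if it is a differential operator of
order `≤ p` in each argument when the other one is fixed. -/
def IsBidifferentialOperator (p : ℕ) (B : A →ₗ[k] A →ₗ[k] A) : Prop :=
  (∀ a, IsDifferentialOperator p (B a)) ∧ ∀ a, IsDifferentialOperator p (B.flip a)

end DifferentialOperators

end PBW

end

/-!
Left multiplication by `x ∈ g`, transported to `S g` through the symmetrization map `e`, should be
the operator `L_x s = ∑ Cₓ(s₁) s₂`, where `∑ s₁ ⊗ s₂` is the comultiplication of `s` and
`Cₓ(yⁿ) = Bₙ ad_y^n x` with the Bernoulli numbers `Bₙ`. Euler's quadratic identity for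
`t / (eᵗ - 1)` says exactly that `x ↦ L_x` is a representation of `g`, so `U g` acts on `S g`.
Since `L_y yⁿ = yⁿ⁺¹` and powers span `S g`, acting on `1 ∈ S g` is a left inverse of `e`, while `e`
is surjective because reordering a product in `U g` costs only shorter products. Hence `e` is
bijective and `B(xⁿ, ·) = L_xⁿ`.

The component of degree `1 - p` of `L_x` involves `Cₓ` only in degree `p`, which makes it a
differential operator of order `≤ p`. Orders add up under composition, so the component
`B_p(xⁿ, ·)` of `L_xⁿ` has order `≤ p` too. Finally, the antipode of `U g` reverses products, which
gives `B_p(y, x) = (-1)^p B_p(x, y)` and settles the other argument.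
-/

noncomputable section

namespace PBW

open scoped DirectSum TensorProduct
open PowerSeries

/-! ### Iterated commutators with multiplications -/

section DifferentialOperators

variable {k A : Type*} [CommRing k] [CommRing A] [Algebra k A]

/-- The commutator `F ↦ [F, a]` of linear endomorphisms with the multiplication by `a`. -/
def mulCommutator (a : A) : Module.End k A →ₗ[k] Module.End k A :=
  LinearMap.mulRight k (LinearMap.mulLeft k a) - LinearMap.mulLeft k (LinearMap.mulLeft k a)

@[simp]
theorem mulCommutator_apply (a : A) (F : Module.End k A) (b : A) :
    mulCommutator a F b = F (a * b) - a * F b := rfl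

theorem mulCommutator_mul (a : A) (F G : Module.End k A) :
    mulCommutator a (F * G) = F * mulCommutator a G + mulCommutator a F * G := by
  ext b
  simp

variable (k A) in
/-- The differential operators of order `< q`: the linear endomorphisms whose `q`-fold commutators
with multiplications vanish. The strict inequality lets the recursion start at `0`. -/
def diffOpLT : ℕ → Submodule k (Module.End k A)
  | 0 => ⊥
  | q + 1 => ⨅ a : A, (diffOpLT q).comap (mulCommutator a)

theorem mem_diffOpLT_zero {F : Module.End k A} : F ∈ diffOpLT k A 0 ↔ F = 0 := Iff.rfl

theorem mem_diffOpLT_succ {q : ℕ} {F : Module.End k A} :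
    F ∈ diffOpLT k A (q + 1) ↔ ∀ a, mulCommutator a F ∈ diffOpLT k A q := by
  simp [diffOpLT]

theorem mul_mem_diffOpLT {p q : ℕ} {F G : Module.End k A} (hF : F ∈ diffOpLT k A (p + 1))
    (hG : G ∈ diffOpLT k A q) : F * G ∈ diffOpLT k A (p + q) := by
  induction p generalizing q F G with
  | zero =>
    induction q generalizing G with
    | zero => rw [mem_diffOpLT_zero.1 hG, mul_zero]; exact zero_mem _
    | succ q ih =>
      refine mem_diffOpLT_succ.2 fun a => ?_
      rw [mulCommutator_mul, mem_diffOpLT_zero.1 (mem_diffOpLT_succ.1 hF a), zero_mul, add_zero]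
      exact ih (mem_diffOpLT_succ.1 hG a)
  | succ p ihp =>
    induction q generalizing G with
    | zero => rw [mem_diffOpLT_zero.1 hG, mul_zero]; exact zero_mem _
    | succ q ihq =>
      refine mem_diffOpLT_succ.2 fun a => ?_
      rw [mulCommutator_mul]
      refine add_mem (ihq (mem_diffOpLT_succ.1 hG a)) ?_
      simpa only [Nat.add_eq, ← add_assoc, Nat.add_right_comm p 1 q] using
        ihp (mem_diffOpLT_succ.1 hF a) hG

theorem mulLeft_mem_diffOpLT_one (c : A) : LinearMap.mulLeft k c ∈ diffOpLT k A 1 :=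
  mem_diffOpLT_succ.2 fun a => mem_diffOpLT_zero.2 <| by ext b; simp [mul_left_comm]

theorem mulLeft_mul_mem_diffOpLT {q : ℕ} {F : Module.End k A} (hF : F ∈ diffOpLT k A q) (c : A) :
    LinearMap.mulLeft k c * F ∈ diffOpLT k A q := by
  simpa using mul_mem_diffOpLT (mulLeft_mem_diffOpLT_one c) hF

theorem mul_mulLeft_mem_diffOpLT {q : ℕ} {F : Module.End k A} (hF : F ∈ diffOpLT k A q) (c : A) :
    F * LinearMap.mulLeft k c ∈ diffOpLT k A q := by
  cases q with
  | zero => simp [mem_diffOpLT_zero.1 hF]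
  | succ q => exact mul_mem_diffOpLT hF (mulLeft_mem_diffOpLT_one c)

theorem mem_diffOpLT_succ_of_adjoin {s : Set A} (hs : Algebra.adjoin k s = ⊤) {q : ℕ}
    {F : Module.End k A} (hF : ∀ a ∈ s, mulCommutator a F ∈ diffOpLT k A q) :
    F ∈ diffOpLT k A (q + 1) := by
  refine mem_diffOpLT_succ.2 fun a => ?_
  have ha : a ∈ Algebra.adjoin k s := hs ▸ Algebra.mem_top
  induction ha using Algebra.adjoin_induction with
  | mem a ha => exact hF a ha
  | algebraMap r =>
    convert (diffOpLT k A q).zero_mem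
    ext b
    simp [← Algebra.smul_def]
  | add a b _ _ ha hb =>
    convert add_mem ha hb using 1
    ext c
    simp only [mulCommutator_apply, LinearMap.add_apply, add_mul, map_add]
    ring
  | mul a b _ _ ha hb =>
    convert add_mem (mul_mulLeft_mem_diffOpLT ha b) (mulLeft_mul_mem_diffOpLT hb a) using 1
    ext c
    simp [mul_assoc, mul_sub]

theorem sum_powerset_eq_zero_of_mem_diffOpLT {ι : Type*} [DecidableEq ι] (s : Finset ι) (a : ι → A)
    {F : Module.End k A} (hF : F ∈ diffOpLT k A s.card) (b : A) :
    ∑ I ∈ s.powerset, (-1) ^ I.card * (∏ i ∈ s \ I, a i) * F ((∏ i ∈ I, a i) * b) = 0 := by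
  induction s using Finset.induction_on generalizing F with
  | empty => simp [mem_diffOpLT_zero.1 hF]
  | insert j s hj ih =>
    rw [Finset.card_insert_of_notMem hj, mem_diffOpLT_succ] at hF
    rw [Finset.sum_powerset_insert hj, ← Finset.sum_add_distrib, ← neg_eq_zero, ← ih (hF (a j)),
      ← Finset.sum_neg_distrib]
    refine Finset.sum_congr rfl fun I hI => ?_
    have hjI : j ∉ I := fun h => hj (Finset.mem_powerset.1 hI h)
    rw [Finset.card_insert_of_notMem hjI, Finset.prod_insert hjI,
      Finset.insert_sdiff_insert, Finset.insert_sdiff_of_notMem _ hjI,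
      Finset.prod_insert (by simp [hj]), Finset.sdiff_insert_of_notMem hj, mulCommutator_apply,
      mul_assoc (a j)]
    ring

theorem isDifferentialOperator_of_mem_diffOpLT {p : ℕ} {F : Module.End k A}
    (hF : F ∈ diffOpLT k A (p + 1)) : IsDifferentialOperator p F := fun a b => by
  simpa [Finset.compl_eq_univ_sdiff] using
    sum_powerset_eq_zero_of_mem_diffOpLT (Finset.univ : Finset (Fin (p + 1))) a
      (by simpa using hF) b

variable (k A) in
/-- The formal series `∑ₚ Fₚ Xᵖ` of linear endomorphisms such that each `Fₚ` is a differential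
operator of order `≤ p`; they form a monoid because orders add up under composition. -/
def diffOpSeries : Submonoid (Module.End k A)⟦X⟧ where
  carrier := {F | ∀ p, coeff p F ∈ diffOpLT k A (p + 1)}
  one_mem' p := by
    rw [coeff_one]
    split_ifs with hp
    · subst hp
      simpa [Module.End.one_eq_id] using mulLeft_mem_diffOpLT_one (k := k) (1 : A)
    · exact zero_mem _
  mul_mem' {F G} hF hG p := by
    rw [coeff_mul]
    refine sum_mem fun ij hij => ?_
    rw [← Finset.HasAntidiagonal.mem_antidiagonal.1 hij, add_assoc]
    exact mul_mem_diffOpLT (hF _) (hG _)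

theorem mem_diffOpSeries {F : (Module.End k A)⟦X⟧} :
    F ∈ diffOpSeries k A ↔ ∀ p, coeff p F ∈ diffOpLT k A (p + 1) := Iff.rfl

end DifferentialOperators

/-! ### Expansions of endomorphisms of graded modules -/

section GradedModules

variable {R M : Type*} [CommRing R] [AddCommGroup M] [Module R M]
variable (𝒜 : ℕ → Submodule R M)

/-- The endomorphism that acts on the homogeneous elements of degree `n` as the scalar `c n`. -/
def gradedScale [DirectSum.Decomposition 𝒜] (c : ℕ → R) : Module.End R M :=
  DirectSum.toModule R ℕ M (fun n => c n • (𝒜 n).subtype) ∘ₗ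
    (DirectSum.decomposeLinearEquiv 𝒜).toLinearMap

variable {𝒜} in
theorem gradedScale_of_mem [DirectSum.Decomposition 𝒜] (c : ℕ → R) {n : ℕ} {s : M}
    (hs : s ∈ 𝒜 n) : gradedScale 𝒜 c s = c n • s := by
  lift s to 𝒜 n using hs
  simp [gradedScale, DirectSum.toModule_lof]

theorem decompose_gradedScale [DirectSum.Decomposition 𝒜] (c : ℕ → R) (s : M) (n : ℕ) :
    (DirectSum.decompose 𝒜 (gradedScale 𝒜 c s) n : M) = c n • DirectSum.decompose 𝒜 s n := by
  induction s using DirectSum.Decomposition.inductionOn 𝒜 with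
  | zero => simp
  | @homogeneous i s =>
    rw [gradedScale_of_mem c s.2, DirectSum.decompose_smul, DirectSum.smul_apply,
      Submodule.coe_smul]
    obtain rfl | hi := eq_or_ne i n
    · rfl
    · rw [DirectSum.decompose_of_mem_ne 𝒜 s.2 hi, smul_zero, smul_zero]
  | add s t hs ht => simp [hs, ht]

/-- `T = ∑ₚ Fₚ` with `Fₚ` homogeneous of degree `d - p`, where `Fₚ` is the coefficient of `Xᵖ` in
`F`. The target degree `m + d - p` is expressed without truncated subtraction, and the terms of
negative target degree vanish. -/
structure HasExpansion (d : ℕ) (T : Module.End R M) (F : (Module.End R M)⟦X⟧) : Prop where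
  coeff_mem : ∀ {p m j : ℕ} {s : M}, s ∈ 𝒜 m → p + j = m + d → coeff p F s ∈ 𝒜 j
  coeff_eq_zero : ∀ {p m : ℕ} {s : M}, s ∈ 𝒜 m → m + d < p → coeff p F s = 0
  eq_sum : ∀ {m N : ℕ} {s : M}, s ∈ 𝒜 m → m + d < N → T s = ∑ p ∈ Finset.range N, coeff p F s

namespace HasExpansion

variable {𝒜} {d d' : ℕ} {T T' : Module.End R M} {F F' : (Module.End R M)⟦X⟧}

theorem one : HasExpansion 𝒜 0 (1 : Module.End R M) 1 where
  coeff_mem {p m j s} hs h := by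
    rw [coeff_one]
    split_ifs with hp
    · obtain rfl : j = m := by omega
      exact hs
    · exact zero_mem _
  coeff_eq_zero {p m s} _ h := by rw [coeff_one, if_neg (by omega), LinearMap.zero_apply]
  eq_sum {m N s} _ h := by
    simp [coeff_one, apply_ite (DFunLike.coe · s), show N ≠ 0 by omega]

theorem mul (h : HasExpansion 𝒜 d T F) (h' : HasExpansion 𝒜 d' T' F') :
    HasExpansion 𝒜 (d + d') (T * T') (F * F') where
  coeff_mem {p m j s} hs hj := by
    rw [coeff_mul, LinearMap.sum_apply]
    refine sum_mem fun ab hab => ?_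
    have hab := Finset.HasAntidiagonal.mem_antidiagonal.1 hab
    rw [Module.End.mul_apply]
    by_cases hb : ab.2 ≤ m + d'
    · exact h.coeff_mem (h'.coeff_mem hs (Nat.add_sub_of_le hb)) (by omega)
    · rw [h'.coeff_eq_zero hs (by omega), map_zero]
      exact zero_mem _
  coeff_eq_zero {p m s} hs hp := by
    rw [coeff_mul, LinearMap.sum_apply]
    refine Finset.sum_eq_zero fun ab hab => ?_
    have hab := Finset.HasAntidiagonal.mem_antidiagonal.1 hab
    rw [Module.End.mul_apply]
    by_cases hb : ab.2 ≤ m + d'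
    · exact h.coeff_eq_zero (h'.coeff_mem hs (Nat.add_sub_of_le hb)) (by omega)
    · rw [h'.coeff_eq_zero hs (by omega), map_zero]
  eq_sum {m N s} hs hN := by
    have expand_left (b : ℕ) (hb : b ∈ Finset.range N) : T (coeff b F' s) =
        ∑ a ∈ Finset.range (N - b), coeff a F (coeff b F' s) := by
      rw [Finset.mem_range] at hb
      by_cases hbm : b ≤ m + d'
      · exact h.eq_sum (h'.coeff_mem hs (Nat.add_sub_of_le hbm)) (by omega)
      · simp [h'.coeff_eq_zero hs (by omega : m + d' < b)]
    calc (T * T') s = ∑ b ∈ Finset.range N, T (coeff b F' s) := by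
          rw [Module.End.mul_apply, h'.eq_sum hs (by omega : m + d' < N), map_sum]
      _ = ∑ b ∈ Finset.range N, ∑ a ∈ Finset.range (N - b), coeff a F (coeff b F' s) :=
          Finset.sum_congr rfl expand_left
      _ = ∑ p ∈ Finset.range N, ∑ b ∈ Finset.range (p + 1), coeff (p - b) F (coeff b F' s) :=
          (Finset.sum_range_diag_flip N fun b a => coeff a F (coeff b F' s)).symm
      _ = ∑ p ∈ Finset.range N, coeff p (F * F') s := by
          refine Finset.sum_congr rfl fun p _ => ?_
          rw [coeff_mul, LinearMap.sum_apply, ← Finset.Nat.sum_antidiagonal_swap,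
            Finset.Nat.sum_antidiagonal_eq_sum_range_succ_mk]
          rfl

theorem pow (h : HasExpansion 𝒜 d T F) (n : ℕ) : HasExpansion 𝒜 (n * d) (T ^ n) (F ^ n) := by
  induction n with
  | zero => simpa using one
  | succ n ih => simpa [pow_succ, add_mul] using ih.mul h

theorem coeff_apply [DirectSum.Decomposition 𝒜] (h : HasExpansion 𝒜 d T F) (p : ℕ) {m : ℕ} {s : M}
    (hs : s ∈ 𝒜 m) :
    coeff p F s = if p ≤ m + d then (DirectSum.decompose 𝒜 (T s) (m + d - p) : M) else 0 := by
  split_ifs with hp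
  · have hmem {q : ℕ} (hq : q < m + d + 1) : coeff q F s ∈ 𝒜 (m + d - q) :=
      h.coeff_mem hs (by omega)
    rw [h.eq_sum hs (Nat.lt_succ_self _), DirectSum.decompose_sum, DFinsupp.finsetSum_apply,
      AddSubmonoidClass.coe_finsetSum,
      Finset.sum_eq_single_of_mem p (Finset.mem_range.2 (by omega)),
      DirectSum.decompose_of_mem_same _ (hmem (by omega))]
    intro q hq hqp
    rw [Finset.mem_range] at hq
    exact DirectSum.decompose_of_mem_ne _ (hmem hq) (by omega)
  · exact h.coeff_eq_zero hs (by omega)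

end HasExpansion

end GradedModules

/-! ### The symmetric algebra -/

section SymmetricAlgebra

variable {k V : Type*} [CommRing k] [AddCommGroup V] [Module k V]

local notation "S" => SymmetricAlgebra k V
local notation "ιS" => SymmetricAlgebra.ι k V

variable (k V) in
theorem adjoin_range_ι : Algebra.adjoin k (Set.range ιS) = ⊤ := by
  rw [eq_top_iff]
  rintro s -
  induction s using SymmetricAlgebra.induction with
  | algebraMap r => exact Subalgebra.algebraMap_mem _ r
  | ι x => exact Algebra.subset_adjoin ⟨x, rfl⟩
  | mul a b ha hb => exact mul_mem ha hb
  | add a b ha hb => exact add_mem ha hb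

@[elab_as_elim]
theorem symmetricAlgebra_induction_ι_mul {P : S → Prop} (one : P 1)
    (smul : ∀ (r : k) s, P s → P (r • s)) (add : ∀ s t, P s → P t → P (s + t))
    (ι_mul : ∀ v s, P s → P (ιS v * s)) (s : S) : P s := by
  suffices h : ∀ t, P t → P (s * t) by simpa using h 1 one
  induction s using SymmetricAlgebra.induction with
  | algebraMap r => exact fun t ht => Algebra.smul_def r t ▸ smul r t ht
  | ι x => exact fun t ht => ι_mul x t ht
  | mul a b ha hb => exact fun t ht => mul_assoc a b t ▸ ha _ (hb t ht)
  | add a b ha hb => exact fun t ht => add_mul a b t ▸ add _ _ (ha t ht) (hb t ht)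

theorem ι_pow_mem_symPow (n : ℕ) (y : V) : ιS y ^ n ∈ symPow k V n :=
  Submodule.pow_mem_pow _ (LinearMap.mem_range_self ιS y) n

variable (k V) in
/-- The involution `s ↦ (-1)ⁿ s` for `s ∈ Sⁿ V`. -/
def gradeInvolution : Module.End k S := gradedScale (symPow k V) fun n => (-1) ^ n

variable (k V) in
/-- The comultiplication of the symmetric algebra, for which `V` is primitive. -/
def comul : S →ₐ[k] S ⊗[k] S :=
  SymmetricAlgebra.lift ((TensorProduct.mk k S S).flip 1 ∘ₗ ιS + TensorProduct.mk k S S 1 ∘ₗ ιS)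

theorem comul_ι (v : V) : comul k V (ιS v) = ιS v ⊗ₜ 1 + 1 ⊗ₜ ιS v := by
  simp [comul]

/-- The operator `s ↦ ∑ C(s₁) s₂` attached to a linear map `C : S V → V`, where `∑ s₁ ⊗ s₂` is the
comultiplication of `s`: the coderivation of `S V` with corestriction `C`. -/
def convOp : (S →ₗ[k] V) →ₗ[k] Module.End k S :=
  LinearMap.lcomp k S (comul k V).toLinearMap ∘ₗ LinearMap.llcomp k _ _ _ (LinearMap.mul' k S) ∘ₗ
    (TensorProduct.mapBilinear (RingHom.id k) S S S S).flip LinearMap.id ∘ₗ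
      LinearMap.llcomp k _ _ _ ιS

theorem convOp_apply (C : S →ₗ[k] V) (s : S) :
    convOp C s = LinearMap.mul' k S (TensorProduct.map (ιS ∘ₗ C) LinearMap.id (comul k V s)) := rfl

theorem convOp_one (C : S →ₗ[k] V) : convOp C 1 = ιS (C 1) := by
  simp [convOp_apply, Algebra.TensorProduct.one_def]

theorem convOp_ι_mul (C : S →ₗ[k] V) (v : V) (s : S) :
    convOp C (ιS v * s) = ιS v * convOp C s + convOp (C ∘ₗ LinearMap.mulLeft k (ιS v)) s := by
  simp only [convOp_apply, map_mul, comul_ι]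
  induction comul k V s using TensorProduct.induction_on with
  | zero => simp
  | tmul a b => simp [add_mul, mul_left_comm, add_comm]
  | add x y hx hy =>
    simp only [mul_add, map_add, hx, hy]
    abel

theorem convOp_pow (C : S →ₗ[k] V) (y : V) (n : ℕ) :
    convOp C (ιS y ^ n) = ∑ x ∈ Finset.HasAntidiagonal.antidiagonal n,
      (n.choose x.1 : k) • (ιS (C (ιS y ^ x.1)) * ιS y ^ x.2) := by
  rw [convOp_apply, map_pow, comul_ι, Commute.add_pow' (Commute.all _ _), map_sum, map_sum]
  refine Finset.sum_congr rfl fun x _ => ?_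
  rw [← Nat.cast_smul_eq_nsmul k]
  simp

theorem mulCommutator_convOp (C : S →ₗ[k] V) (v : V) :
    mulCommutator (ιS v) (convOp C) = convOp (C ∘ₗ LinearMap.mulLeft k (ιS v)) := by
  ext s
  simp [convOp_ι_mul]

theorem convOp_mem_diffOpLT {q : ℕ} {C : S →ₗ[k] V}
    (hC : ∀ n, q ≤ n → ∀ s ∈ symPow k V n, C s = 0) : convOp C ∈ diffOpLT k S q := by
  induction q generalizing C with
  | zero =>
    have : C = 0 := DirectSum.decompose_lhom_ext (symPow k V) fun n =>
      LinearMap.ext fun s => hC n n.zero_le s s.2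
    rw [this, map_zero]
    exact zero_mem _
  | succ q ih =>
    refine mem_diffOpLT_succ_of_adjoin (adjoin_range_ι k V) ?_
    rintro _ ⟨v, rfl⟩
    rw [mulCommutator_convOp]
    refine ih fun n hn s hs => hC (1 + n) (by omega) _ ?_
    exact SetLike.mul_mem_graded (ι_mem_symPow k V v) hs

theorem convOp_commutator (C D : S →ₗ[k] V) :
    convOp C * convOp D - convOp D * convOp C = convOp (C ∘ₗ convOp D - D ∘ₗ convOp C) := by
  ext s
  simp only [LinearMap.sub_apply, Module.End.mul_apply]
  induction s using symmetricAlgebra_induction_ι_mul generalizing C D with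
  | one =>
    have convOp_convOp_one (C D : S →ₗ[k] V) :
        convOp C (convOp D 1) = ιS (D 1) * ιS (C 1) + ιS (C (convOp D 1)) := by
      rw [convOp_one, ← mul_one (ιS (D 1)), convOp_ι_mul, convOp_one, convOp_one]
      simp
    rw [convOp_convOp_one, convOp_convOp_one, convOp_one (C ∘ₗ convOp D - D ∘ₗ convOp C)]
    simp only [LinearMap.sub_apply, LinearMap.comp_apply, map_sub]
    ring
  | smul r s h => rw [map_smul, map_smul, map_smul, map_smul, map_smul, ← smul_sub, h]
  | add s t hs ht =>
    simp only [map_add]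
    rw [← hs, ← ht]
    abel
  | ι_mul v s h =>
    have leibniz : (C ∘ₗ convOp D - D ∘ₗ convOp C) ∘ₗ LinearMap.mulLeft k (ιS v) =
        ((C ∘ₗ LinearMap.mulLeft k (ιS v)) ∘ₗ convOp D -
          D ∘ₗ convOp (C ∘ₗ LinearMap.mulLeft k (ιS v))) +
        (C ∘ₗ convOp (D ∘ₗ LinearMap.mulLeft k (ιS v)) -
          (D ∘ₗ LinearMap.mulLeft k (ιS v)) ∘ₗ convOp C) := by
      ext s
      simp only [LinearMap.comp_apply, LinearMap.sub_apply, LinearMap.add_apply,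
        LinearMap.mulLeft_apply, convOp_ι_mul, map_add]
      abel
    rw [convOp_ι_mul (C ∘ₗ convOp D - D ∘ₗ convOp C), leibniz, map_add convOp, LinearMap.add_apply,
      ← h, ← h, ← h]
    simp only [convOp_ι_mul, map_add, mul_sub]
    abel

theorem convOp_apply_eq_zero {C : S →ₗ[k] V} {m : ℕ}
    (hC : ∀ i ≤ m, ∀ s ∈ symPow k V i, C s = 0) {s : S} (hs : s ∈ symPow k V m) :
    convOp C s = 0 := by
  unfold symPow at hs
  induction hs using Submodule.pow_induction_on_left' generalizing C with
  | algebraMap r =>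
    rw [Algebra.algebraMap_eq_smul_one, map_smul, convOp_one,
      hC 0 le_rfl 1 SetLike.GradedOne.one_mem, map_zero, smul_zero]
  | add s t i _ _ hs ht => rw [map_add, hs hC, ht hC, add_zero]
  | mem_mul a ha i s _ ih =>
    obtain ⟨v, rfl⟩ := ha
    rw [convOp_ι_mul, ih fun j hj => hC j (by omega), mul_zero, zero_add]
    exact ih fun j hj s hs =>
      hC (1 + j) (by omega) _ (SetLike.mul_mem_graded (ι_mem_symPow k V v) hs)

theorem convOp_apply_mem_symPow {C : S →ₗ[k] V} {p m j : ℕ}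
    (hC : ∀ i ≠ p, ∀ s ∈ symPow k V i, C s = 0) {s : S} (hs : s ∈ symPow k V m)
    (hj : p + j = m + 1) : convOp C s ∈ symPow k V j := by
  unfold symPow at hs
  induction hs using Submodule.pow_induction_on_left' generalizing C p j with
  | algebraMap r =>
    rw [Algebra.algebraMap_eq_smul_one, map_smul, convOp_one]
    refine Submodule.smul_mem _ r ?_
    rcases eq_or_ne p 0 with rfl | hp
    · obtain rfl : j = 1 := by omega
      exact ι_mem_symPow k V _
    · rw [hC 0 hp.symm 1 SetLike.GradedOne.one_mem, map_zero]
      exact zero_mem _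
  | add s t i _ _ hs ht => rw [map_add]; exact add_mem (hs hC hj) (ht hC hj)
  | mem_mul a ha i s hs ih =>
    obtain ⟨v, rfl⟩ := ha
    have hCv (p' : ℕ) (hp' : 1 + p' ≠ p) (t : S) (ht : t ∈ symPow k V p') :
        C (ιS v * t) = 0 :=
      hC _ hp' _ (SetLike.mul_mem_graded (ι_mem_symPow k V v) ht)
    rw [convOp_ι_mul]
    refine add_mem ?_ ?_
    · cases j with
      | zero =>
        rw [convOp_apply_eq_zero (fun i hi => hC i (by omega)) hs, mul_zero]
        exact zero_mem _
      | succ j =>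
        rw [add_comm j]
        exact SetLike.mul_mem_graded (ι_mem_symPow k V v) (ih hC (by omega))
    · cases p with
      | zero =>
        rw [convOp_apply_eq_zero (fun i _ => hCv i (by omega)) hs]
        exact zero_mem _
      | succ p => exact ih (p := p) (fun i hi => hCv i (by omega)) (by omega)

/-- The expansion of `convOp C` into its homogeneous components, see `hasExpansion_convOp`. -/
def convOpSeries (C : S →ₗ[k] V) : (Module.End k S)⟦X⟧ :=
  PowerSeries.mk fun p => convOp (C ∘ₗ GradedAlgebra.proj (symPow k V) p)

theorem comp_proj_apply_eq_zero (C : S →ₗ[k] V) {p i : ℕ} (hi : i ≠ p) {s : S}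
    (hs : s ∈ symPow k V i) : (C ∘ₗ GradedAlgebra.proj (symPow k V) p) s = 0 := by
  rw [LinearMap.comp_apply, GradedAlgebra.proj_apply, DirectSum.decompose_of_mem_ne _ hs hi,
    map_zero]

theorem convOpSeries_mem_diffOpSeries (C : S →ₗ[k] V) : convOpSeries C ∈ diffOpSeries k S :=
  mem_diffOpSeries.2 fun p => by
    rw [convOpSeries, coeff_mk]
    exact convOp_mem_diffOpLT fun n hn s hs => comp_proj_apply_eq_zero C (by omega) hs

theorem hasExpansion_convOp (C : S →ₗ[k] V) :
    HasExpansion (symPow k V) 1 (convOp C) (convOpSeries C) where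
  coeff_mem hs hj := by
    rw [convOpSeries, coeff_mk]
    exact convOp_apply_mem_symPow (fun i hi s => comp_proj_apply_eq_zero C hi) hs hj
  coeff_eq_zero hs hp := by
    rw [convOpSeries, coeff_mk]
    exact convOp_apply_eq_zero (fun i hi s => comp_proj_apply_eq_zero C (by omega)) hs
  eq_sum {m N s} hs hN := by
    simp only [convOpSeries, coeff_mk]
    rw [← LinearMap.sum_apply, ← map_sum, ← sub_eq_zero, ← LinearMap.sub_apply, ← map_sub]
    refine convOp_apply_eq_zero (fun i hi t ht => ?_) hs
    rw [LinearMap.sub_apply, LinearMap.sum_apply,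
      Finset.sum_eq_single_of_mem i (Finset.mem_range.2 (by omega))
        fun p _ hp => comp_proj_apply_eq_zero C hp.symm ht,
      LinearMap.comp_apply, GradedAlgebra.proj_apply, DirectSum.decompose_of_mem_same _ ht,
      sub_self]

end SymmetricAlgebra

section Polarization

variable {k V M : Type*} [Field k] [AddCommGroup V] [Module k V] [AddCommGroup M] [Module k M]

local notation "S" => SymmetricAlgebra k V
local notation "ιS" => SymmetricAlgebra.ι k V

theorem eq_zero_of_forall_sum_pow_smul_eq_zero [Infinite k] {n : ℕ} {m : ℕ → M}
    (h : ∀ t : k, ∑ i ∈ Finset.range n, t ^ i • m i = 0) {i : ℕ} (hi : i < n) : m i = 0 := by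
  rw [← Module.forall_dual_apply_eq_zero_iff k]
  intro f
  have hp : ∑ j ∈ Finset.range n, Polynomial.C (f (m j)) * Polynomial.X ^ j = 0 := by
    refine Polynomial.funext fun t => ?_
    simpa [Polynomial.eval_finsetSum, mul_comm (f _)] using congrArg f (h t)
  simpa [Polynomial.finsetSum_coeff, Polynomial.coeff_C_mul, Polynomial.coeff_X_pow, hi] using
    congrArg (Polynomial.coeff · i) hp

theorem mem_of_forall_sum_pow_smul_mem [Infinite k] (N : Submodule k M) {n : ℕ} {m : ℕ → M}
    (h : ∀ t : k, ∑ i ∈ Finset.range n, t ^ i • m i ∈ N) {i : ℕ} (hi : i < n) : m i ∈ N := by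
  rw [← Submodule.Quotient.mk_eq_zero]
  refine eq_zero_of_forall_sum_pow_smul_eq_zero (k := k) (m := fun i => N.mkQ (m i))
    (fun t => ?_) hi
  rw [← (Submodule.Quotient.mk_eq_zero N).2 (h t), ← Submodule.mkQ_apply]
  simp only [map_sum, map_smul]

variable [CharZero k]

theorem ι_mul_pow_mem_span_pow (v y : V) (n : ℕ) :
    ιS v * ιS y ^ n ∈ Submodule.span k (Set.range fun x : ℕ × V => ιS x.2 ^ x.1) := by
  have h := mem_of_forall_sum_pow_smul_mem (k := k)
    (Submodule.span k (Set.range fun x : ℕ × V => ιS x.2 ^ x.1)) (n := n + 1 + 1)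
    (m := fun i => ((n + 1).choose i : k) • (ιS v ^ i * ιS y ^ (n + 1 - i))) (i := 1)
    (fun t => Submodule.subset_span ⟨(n + 1, t • v + y), ?_⟩) (by omega)
  · rw [Submodule.smul_mem_iff _ (by simpa using n.cast_add_one_ne_zero)] at h
    simpa using h
  · simp only [map_add, map_smul, add_pow, smul_pow]
    refine Finset.sum_congr rfl fun i _ => ?_
    simp only [Algebra.smul_def, map_natCast, map_pow]
    ring

variable (k V) in
theorem span_pow : Submodule.span k (Set.range fun x : ℕ × V => ιS x.2 ^ x.1) = ⊤ := by
  rw [eq_top_iff]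
  rintro s -
  induction s using symmetricAlgebra_induction_ι_mul with
  | one => exact Submodule.subset_span ⟨(0, 0), pow_zero _⟩
  | smul r s hs => exact Submodule.smul_mem _ r hs
  | add s t hs ht => exact add_mem hs ht
  | ι_mul v s hs =>
    induction hs using Submodule.span_induction with
    | mem s hs =>
      obtain ⟨⟨n, y⟩, rfl⟩ := hs
      exact ι_mul_pow_mem_span_pow v y n
    | zero => rw [mul_zero]; exact zero_mem _
    | add s t _ _ hs ht => rw [mul_add]; exact add_mem hs ht
    | smul r s _ hs => rw [mul_smul_comm]; exact Submodule.smul_mem _ r hs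

theorem linearMap_ext_pow {F G : S →ₗ[k] M} (h : ∀ n y, F (ιS y ^ n) = G (ιS y ^ n)) : F = G :=
  LinearMap.ext_on_range (span_pow k V) fun x => h x.1 x.2

end Polarization

/-! ### Euler's identity for Bernoulli numbers -/

section Bernoulli

variable (R : Type*) [CommRing R]

/-- The coefficient `Bₙ / n!` of `tⁿ` in `t / (eᵗ - 1)`, in a `ℚ`-algebra. -/
def bernoulliCoeff [Algebra ℚ R] (n : ℕ) : R := algebraMap ℚ R (bernoulli n / n.factorial)

variable {R}

theorem coeff_rescale_bernoulliPowerSeries [Algebra ℚ R] (a : R) (n : ℕ) :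
    coeff n (rescale a (bernoulliPowerSeries R)) = a ^ n * bernoulliCoeff R n := by
  rw [coeff_rescale, bernoulliPowerSeries, coeff_mk, bernoulliCoeff]

/-- The series `(f((a + b) X) - f(a X)) / (b X)`, where `f` is the generating function of the
sequence `f`, with the division by `b X` carried out. -/
def diffQuot (f : ℕ → R) (a b : R) : R⟦X⟧ :=
  PowerSeries.mk fun q => f (q + 1) * ∑ i ∈ Finset.range (q + 1), (a + b) ^ i * a ^ (q - i)

theorem C_mul_X_mul_diffQuot (f : ℕ → R) (a b : R) :
    C b * X * diffQuot f a b =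
      rescale (a + b) (PowerSeries.mk f) - rescale a (PowerSeries.mk f) := by
  ext n
  rw [mul_assoc, coeff_C_mul]
  cases n with
  | zero => rw [map_sub, coeff_rescale, coeff_rescale, coeff_zero_X_mul]; simp
  | succ n =>
    have geom := (Commute.all (a + b) a).geom_sum₂_mul (n + 1)
    rw [add_sub_cancel_left] at geom
    rw [coeff_succ_X_mul, diffQuot, coeff_mk, map_sub, coeff_rescale, coeff_rescale, coeff_mk,
      ← sub_mul, ← geom]
    simp only [Nat.add_sub_cancel]
    ring

variable [Algebra ℚ R]

theorem rescale_bernoulliPowerSeries_mul (c : R) :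
    rescale c (bernoulliPowerSeries R) * (rescale c (exp R) - 1) = C c * X := by
  simpa [rescale_X] using congrArg (rescale c) (bernoulliPowerSeries_mul_exp_sub_one R)

theorem rescale_exp_sub_one_ne_zero [IsDomain R] {c : R} (hc : c ≠ 0) :
    rescale c (exp R) - 1 ≠ 0 := fun h => by
  have hcX : C c * X ≠ (0 : R⟦X⟧) := mul_ne_zero ((map_ne_zero_iff _ C_injective).2 hc) X_ne_zero
  rw [← rescale_bernoulliPowerSeries_mul, h, mul_zero] at hcX
  exact hcX rfl

theorem bernoulli_euler [IsDomain R] {a b : R} (ha : a ≠ 0) (hb : b ≠ 0) :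
    rescale b (bernoulliPowerSeries R) * diffQuot (bernoulliCoeff R) a b +
      rescale a (bernoulliPowerSeries R) * diffQuot (bernoulliCoeff R) b a =
      -rescale (a + b) (bernoulliPowerSeries R) := by
  have hφa := rescale_bernoulliPowerSeries_mul a
  have hφb := rescale_bernoulliPowerSeries_mul b
  have hφab := rescale_bernoulliPowerSeries_mul (a + b)
  rw [← exp_mul_exp_eq_exp_add, map_add] at hφab
  have hQab : C b * X * diffQuot (bernoulliCoeff R) a b =
      rescale (a + b) (bernoulliPowerSeries R) - rescale a (bernoulliPowerSeries R) :=
    C_mul_X_mul_diffQuot _ a b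
  have hQba : C a * X * diffQuot (bernoulliCoeff R) b a =
      rescale (a + b) (bernoulliPowerSeries R) - rescale b (bernoulliPowerSeries R) :=
    add_comm b a ▸ C_mul_X_mul_diffQuot _ b a
  refine mul_left_cancel₀
    (mul_ne_zero (rescale_exp_sub_one_ne_zero ha) (rescale_exp_sub_one_ne_zero hb)) ?_
  linear_combination
    (rescale a (exp R) - 1) * diffQuot (bernoulliCoeff R) a b * hφb +
    (rescale b (exp R) - 1) * diffQuot (bernoulliCoeff R) b a * hφa +
    (rescale a (exp R) - 1) * hQab + (rescale b (exp R) - 1) * hQba - hφa - hφb + hφab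

theorem coeff_rescale_mul_diffQuot (a b : R) (n : ℕ) :
    coeff n (rescale b (bernoulliPowerSeries R) * diffQuot (bernoulliCoeff R) a b) =
      ∑ p ∈ Finset.HasAntidiagonal.antidiagonal n,
        bernoulliCoeff R p.1 * bernoulliCoeff R (p.2 + 1) *
          ∑ i ∈ Finset.range (p.2 + 1), (a + b) ^ i * (a ^ (p.2 - i) * b ^ p.1) := by
  rw [coeff_mul]
  refine Finset.sum_congr rfl fun p _ => ?_
  rw [coeff_rescale_bernoulliPowerSeries, diffQuot, coeff_mk]
  simp only [← mul_assoc, ← Finset.sum_mul]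
  ring

end Bernoulli

section BernoulliBracket

variable {k g : Type*} [CommRing k] [LieRing g] [LieAlgebra k g]

/-- The linear map from polynomials in two variables to `g` that sends `X₀^i X₁^j` to
`[ad_y^i x, ad_y^j x']`. Since `ad_y` is a derivation, `X₀ + X₁` acts as `ad_y`. -/
def bracketEval (y x x' : g) : MvPolynomial (Fin 2) k →ₗ[k] g :=
  (MvPolynomial.basisMonomials (Fin 2) k).constr k fun m =>
    ⁅(LieAlgebra.ad k g y ^ m 0) x, (LieAlgebra.ad k g y ^ m 1) x'⁆

theorem bracketEval_monomial (y x x' : g) (i j : ℕ) :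
    bracketEval (k := k) y x x' (MvPolynomial.X 0 ^ i * MvPolynomial.X 1 ^ j) =
      ⁅(LieAlgebra.ad k g y ^ i) x, (LieAlgebra.ad k g y ^ j) x'⁆ := by
  have hbasis : (MvPolynomial.X 0 ^ i * MvPolynomial.X 1 ^ j : MvPolynomial (Fin 2) k) =
      MvPolynomial.basisMonomials (Fin 2) k (Finsupp.single 0 i + Finsupp.single 1 j) := by
    simp [MvPolynomial.X_pow_eq_monomial, MvPolynomial.monomial_mul]
  rw [hbasis, bracketEval, Module.Basis.constr_basis]
  simp

theorem bracketEval_add_mul (y x x' : g) (P : MvPolynomial (Fin 2) k) :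
    bracketEval y x x' ((MvPolynomial.X 0 + MvPolynomial.X 1) * P) = ⁅y, bracketEval y x x' P⁆ := by
  suffices h : bracketEval y x x' ∘ₗ LinearMap.mulLeft k (MvPolynomial.X 0 + MvPolynomial.X 1) =
      LieAlgebra.ad k g y ∘ₗ bracketEval y x x' from LinearMap.congr_fun h P
  refine (MvPolynomial.basisMonomials (Fin 2) k).ext fun m => ?_
  have hm : MvPolynomial.basisMonomials (Fin 2) k m =
      MvPolynomial.X 0 ^ m 0 * MvPolynomial.X 1 ^ m 1 := by
    simp [MvPolynomial.monomial_eq, Finsupp.prod_fintype]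
  simp only [hm, LinearMap.comp_apply, LinearMap.mulLeft_apply, LieAlgebra.ad_apply]
  rw [bracketEval_monomial, leibniz_lie, add_mul, map_add, ← mul_assoc, ← pow_succ',
    mul_left_comm, ← pow_succ', bracketEval_monomial, bracketEval_monomial, pow_succ', pow_succ']
  rfl

theorem bracketEval_add_pow_mul (y x x' : g) (n : ℕ) (P : MvPolynomial (Fin 2) k) :
    bracketEval y x x' ((MvPolynomial.X 0 + MvPolynomial.X 1) ^ n * P) =
      (LieAlgebra.ad k g y ^ n) (bracketEval y x x' P) := by
  induction n with
  | zero => simp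
  | succ n ih =>
    rw [pow_succ', mul_assoc, bracketEval_add_mul, ih, pow_succ']
    rfl

variable [Algebra ℚ k]

theorem algebraMap_bernoulliCoeff (A : Type*) [CommRing A] [Algebra k A] [Algebra ℚ A] (n : ℕ) :
    algebraMap k A (bernoulliCoeff k n) = bernoulliCoeff A n :=
  RingHom.congr_fun (RingHom.ext_rat ((algebraMap k A).comp (algebraMap ℚ k)) (algebraMap ℚ A)) _

theorem bracketEval_bernoulliCoeff_mul (y x x' : g) (n : ℕ) (P : MvPolynomial (Fin 2) k) :
    bracketEval y x x' (bernoulliCoeff _ n * P) = bernoulliCoeff k n • bracketEval y x x' P := by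
  rw [← algebraMap_bernoulliCoeff (k := k), ← Algebra.smul_def, map_smul]

variable (k) in
/-- The sum `∑_{p + q = n} β_p β_{q + 1} ∑_{i ≤ q} ad_y^i [ad_y^p x, ad_y^(q - i) x']`, where
`β_n = Bₙ / n!`. -/
def bernoulliBracket (y x x' : g) (n : ℕ) : g :=
  ∑ p ∈ Finset.HasAntidiagonal.antidiagonal n,
    (bernoulliCoeff k p.1 * bernoulliCoeff k (p.2 + 1)) • ∑ i ∈ Finset.range (p.2 + 1),
      (LieAlgebra.ad k g y ^ i)
        ⁅(LieAlgebra.ad k g y ^ p.1) x, (LieAlgebra.ad k g y ^ (p.2 - i)) x'⁆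

theorem bracketEval_coeff_rescale_X_zero (y x x' : g) (n : ℕ) :
    bracketEval (k := k) y x x' (coeff n (rescale (MvPolynomial.X 0) (bernoulliPowerSeries _) *
      diffQuot (bernoulliCoeff _) (MvPolynomial.X 1) (MvPolynomial.X 0))) =
      bernoulliBracket k y x x' n := by
  simp only [coeff_rescale_mul_diffQuot, bernoulliBracket, map_sum, mul_assoc, mul_smul,
    bracketEval_bernoulliCoeff_mul, add_comm (MvPolynomial.X 1 : MvPolynomial (Fin 2) k),
    mul_comm (MvPolynomial.X 1 ^ _ : MvPolynomial (Fin 2) k), bracketEval_add_pow_mul,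
    bracketEval_monomial]

theorem bracketEval_coeff_rescale_X_one (y x x' : g) (n : ℕ) :
    bracketEval (k := k) y x x' (coeff n (rescale (MvPolynomial.X 1) (bernoulliPowerSeries _) *
      diffQuot (bernoulliCoeff _) (MvPolynomial.X 0) (MvPolynomial.X 1))) =
      -bernoulliBracket k y x' x n := by
  simp only [coeff_rescale_mul_diffQuot, bernoulliBracket, map_sum, mul_assoc, mul_smul,
    bracketEval_bernoulliCoeff_mul, bracketEval_add_pow_mul, bracketEval_monomial,
    ← Finset.sum_neg_distrib, ← smul_neg, ← map_neg, lie_skew]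

theorem bernoulliBracket_sub_swap [IsDomain k] (y x x' : g) (n : ℕ) :
    bernoulliBracket k y x' x n - bernoulliBracket k y x x' n =
      bernoulliCoeff k n • (LieAlgebra.ad k g y ^ n) ⁅x, x'⁆ := by
  have euler := congrArg (bracketEval y x x') (congrArg (coeff n) (bernoulli_euler
    (MvPolynomial.X_ne_zero (R := k) (0 : Fin 2)) (MvPolynomial.X_ne_zero (R := k) 1)))
  have hbracket : bracketEval (k := k) y x x' 1 = ⁅x, x'⁆ := by
    simpa using bracketEval_monomial (k := k) y x x' 0 0
  rw [map_add, map_add, map_neg, map_neg, bracketEval_coeff_rescale_X_zero,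
    bracketEval_coeff_rescale_X_one, coeff_rescale_bernoulliPowerSeries, bracketEval_add_pow_mul,
    ← mul_one (bernoulliCoeff _ n), bracketEval_bernoulliCoeff_mul, hbracket, map_smul] at euler
  rw [← neg_inj, ← euler]
  abel

end BernoulliBracket

/-! ### Values and surjectivity of the symmetrization map -/

attribute [local instance] LieRing.ofAssociativeRing

section Permutations

theorem prod_ofFn_ite {M : Type*} [Monoid M] (y z : M) (n : ℕ) (i : Fin (n + 1)) :
    (List.ofFn fun j => if j = i then z else y).prod = y ^ (i : ℕ) * z * y ^ (n - i) := by
  induction n with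
  | zero => simp [Fin.eq_zero i]
  | succ n ih =>
    rw [List.ofFn_succ, List.prod_cons]
    induction i using Fin.cases with
    | zero => simp [Fin.succ_ne_zero, pow_succ']
    | succ i =>
      simp only [Fin.succ_inj, ih, (Fin.succ_ne_zero i).symm, if_false, Fin.val_succ,
        Nat.add_sub_add_right, pow_succ', mul_assoc]

theorem sum_perm_symm_zero {M : Type*} [AddCommMonoid M] (n : ℕ) (f : Fin (n + 1) → M) :
    ∑ σ : Equiv.Perm (Fin (n + 1)), f (σ.symm 0) = n.factorial • ∑ i, f i := by
  rw [← Equiv.sum_comp (Equiv.inv (Equiv.Perm (Fin (n + 1)))),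
    ← Equiv.sum_comp Equiv.Perm.decomposeFin.symm, Fintype.sum_prod_type, Finset.smul_sum]
  refine Finset.sum_congr rfl fun i _ => ?_
  simp only [Equiv.inv_apply, ← Equiv.Perm.inv_def, inv_inv,
    Equiv.Perm.decomposeFin_symm_apply_zero]
  rw [Finset.sum_const, Finset.card_univ, Fintype.card_perm, Fintype.card_fin]

theorem cons_const_perm_apply {α : Type*} (y z : α) {n : ℕ} (σ : Equiv.Perm (Fin (n + 1)))
    (i : Fin (n + 1)) :
    (Fin.cons z fun _ => y : Fin (n + 1) → α) (σ i) = if i = σ.symm 0 then z else y := by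
  simp only [Equiv.eq_symm_apply]
  cases σ i using Fin.cases <;> simp [Fin.succ_ne_zero]

end Permutations

section EnvFiltration

variable {k g : Type*} [CommRing k] [LieRing g] [LieAlgebra k g]

local notation "U" => UniversalEnvelopingAlgebra k g
local notation "ιU" => UniversalEnvelopingAlgebra.ι k (L := g)

variable (k g) in
/-- The standard filtration of the enveloping algebra, shifted by one so that it starts with `0`:
the span of the products of fewer than `n` elements of `g`. -/
def envFiltration (n : ℕ) : Submodule k U :=
  Submodule.span k {u | ∃ l : List g, l.length < n ∧ (l.map ιU).prod = u}

theorem ι_mul_mem_envFiltration (x : g) {n : ℕ} {u : U} (hu : u ∈ envFiltration k g n) :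
    ιU x * u ∈ envFiltration k g (n + 1) := by
  suffices h : envFiltration k g n ≤
      (envFiltration k g (n + 1)).comap (LinearMap.mulLeft k (ιU x)) from h hu
  refine Submodule.span_le.2 ?_
  rintro _ ⟨l, hl, rfl⟩
  exact Submodule.subset_span ⟨x :: l, by simpa using hl, by simp⟩

theorem prod_sub_prod_mem_envFiltration {l l' : List g} (h : l.Perm l') :
    (l.map ιU).prod - (l'.map ιU).prod ∈ envFiltration k g l.length := by
  induction h with
  | nil => simp
  | cons x _ ih =>
    simp only [List.map_cons, List.prod_cons, ← mul_sub, List.length_cons]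
    exact ι_mul_mem_envFiltration x ih
  | swap x y l =>
    refine Submodule.subset_span ⟨⁅y, x⁆ :: l, by simp, ?_⟩
    simp [LieRing.of_associative_ring_bracket, sub_mul, mul_assoc]
  | trans h _ ih ih' =>
    rw [← sub_add_sub_cancel]
    exact add_mem ih (h.length_eq ▸ ih')

end EnvFiltration

section Symmetrization

variable {k g : Type*} [Field k] [CharZero k] [LieRing g] [LieAlgebra k g]

local notation "ιS" => SymmetricAlgebra.ι k g
local notation "ιU" => UniversalEnvelopingAlgebra.ι k (L := g)

theorem symmetrization_pow (y : g) (n : ℕ) :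
    symmetrization k g (ιS y ^ n) = ιU y ^ n := by
  have h := symmetrization_prod k g n fun _ => y
  have hn : (n.factorial : k) ≠ 0 := Nat.cast_ne_zero.2 n.factorial_ne_zero
  rw [Finset.prod_const, Finset.card_univ, Fintype.card_fin] at h
  rw [h, List.ofFn_const, List.prod_replicate, Finset.sum_const, Finset.card_univ,
    Fintype.card_perm, Fintype.card_fin, ← Nat.cast_smul_eq_nsmul k, inv_smul_smul₀ hn]

theorem symmetrization_ι_mul_pow (y z : g) (n : ℕ) :
    symmetrization k g (ιS z * ιS y ^ n) =
      (n + 1 : k)⁻¹ • ∑ i ∈ Finset.range (n + 1), ιU y ^ i * ιU z * ιU y ^ (n - i) := by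
  have h := symmetrization_prod k g (n + 1) (Fin.cons z fun _ => y)
  simp only [Fin.prod_univ_succ, Fin.cons_zero, Fin.cons_succ, Finset.prod_const, Finset.card_univ,
    Fintype.card_fin, cons_const_perm_apply, apply_ite ιU, prod_ofFn_ite] at h
  have hn : (n.factorial : k) ≠ 0 := Nat.cast_ne_zero.2 n.factorial_ne_zero
  rw [h, sum_perm_symm_zero n fun i => ιU y ^ (i : ℕ) * ιU z * ιU y ^ (n - (i : ℕ)),
    Fin.sum_univ_eq_sum_range fun i => ιU y ^ i * ιU z * ιU y ^ (n - i),
    ← Nat.cast_smul_eq_nsmul k, smul_smul, Nat.factorial_succ]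
  congr 1
  push_cast
  field_simp

theorem prod_sub_symmetrization_mem_envFiltration (l : List g) :
    (l.map ιU).prod - symmetrization k g (∏ i, ιS (l.get i)) ∈ envFiltration k g l.length := by
  have hn : (l.length.factorial : k) ≠ 0 := Nat.cast_ne_zero.2 l.length.factorial_ne_zero
  have hperm (σ : Equiv.Perm (Fin l.length)) :
      (l.map ιU).prod - (List.ofFn fun i => ιU (l.get (σ i))).prod ∈
        envFiltration k g l.length := by
    have := prod_sub_prod_mem_envFiltration (k := k) (l := l) (l' := List.ofFn (l.get ∘ σ))
      (List.Perm.symm (by simpa using Equiv.Perm.ofFn_comp_perm σ l.get))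
    rwa [List.map_ofFn] at this
  have hsum := sum_mem fun σ (_ : σ ∈ Finset.univ) => hperm σ
  rw [Finset.sum_sub_distrib, Finset.sum_const, Finset.card_univ, Fintype.card_perm,
    Fintype.card_fin, ← Nat.cast_smul_eq_nsmul k] at hsum
  rw [symmetrization_prod, ← Submodule.smul_mem_iff _ hn, smul_sub, smul_inv_smul₀ hn]
  exact hsum

theorem envFiltration_le_range_symmetrization (n : ℕ) :
    envFiltration k g n ≤ LinearMap.range (symmetrization k g) := by
  induction n using Nat.strong_induction_on with
  | _ n ih =>
    refine Submodule.span_le.2 ?_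
    rintro _ ⟨l, hl, rfl⟩
    rw [← sub_add_cancel (l.map ιU).prod (symmetrization k g (∏ i, ιS (l.get i)))]
    exact add_mem (ih _ hl (prod_sub_symmetrization_mem_envFiltration l))
      (LinearMap.mem_range_self _ _)

variable (k g) in
theorem symmetrization_surjective : Function.Surjective (symmetrization k g) := by
  have hmk : LinearMap.range (UniversalEnvelopingAlgebra.mkAlgHom k g).toLinearMap = ⊤ :=
    LinearMap.range_eq_top.2 Quotient.mk_surjective
  rw [← LinearMap.range_eq_top, eq_top_iff, ← hmk, LinearMap.range_eq_map, ← tensor_span k g,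
    Submodule.map_span, Submodule.span_le]
  rintro _ ⟨_, ⟨l, rfl⟩, rfl⟩
  refine envFiltration_le_range_symmetrization (l.length + 1)
    (Submodule.subset_span ⟨l, Nat.lt_succ_self _, ?_⟩)
  simp only [AlgHom.toLinearMap_apply, map_list_prod, List.map_map]
  rfl

end Symmetrization

/-! ### The left regular representation on the symmetric algebra -/

section LeftRepresentation

variable {k g : Type*} [Field k] [CharZero k] [LieRing g] [LieAlgebra k g]

local notation "S" => SymmetricAlgebra k g
local notation "ιS" => SymmetricAlgebra.ι k g
local notation "U" => UniversalEnvelopingAlgebra k g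
local notation "ιU" => UniversalEnvelopingAlgebra.ι k (L := g)

variable (k g) in
/-- The bilinear map that sends `x` and `yⁿ` to `Bₙ ad_y^n x`, where `Bₙ` is the Bernoulli number.
It acts on `x` through the symmetrization map and the adjoint representation of `U g`. -/
def bernoulliEval : g →ₗ[k] S →ₗ[k] g :=
  ((UniversalEnvelopingAlgebra.lift k (LieAlgebra.ad k g)).toLinearMap ∘ₗ symmetrization k g ∘ₗ
    gradedScale (symPow k g) fun n => n.factorial * bernoulliCoeff k n).flip

theorem bernoulliEval_pow (x y : g) (n : ℕ) :
    bernoulliEval k g x (ιS y ^ n) =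
      (n.factorial * bernoulliCoeff k n : k) • (LieAlgebra.ad k g y ^ n) x := by
  simp [bernoulliEval, gradedScale_of_mem _ (ι_pow_mem_symPow n y), symmetrization_pow]

theorem bernoulliEval_ι_mul_pow (x y z : g) (n : ℕ) :
    bernoulliEval k g x (ιS z * ιS y ^ n) =
      (n.factorial * bernoulliCoeff k (n + 1) : k) • ∑ i ∈ Finset.range (n + 1),
        (LieAlgebra.ad k g y ^ i) ⁅z, (LieAlgebra.ad k g y ^ (n - i)) x⁆ := by
  have hmem : ιS z * ιS y ^ n ∈ symPow k g (n + 1) :=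
    add_comm 1 n ▸ SetLike.mul_mem_graded (ι_mem_symPow k g z) (ι_pow_mem_symPow n y)
  have hn : (n + 1 : k) ≠ 0 := n.cast_add_one_ne_zero
  have hscale : (((n + 1).factorial * bernoulliCoeff k (n + 1)) * (n + 1 : k)⁻¹ : k) =
      n.factorial * bernoulliCoeff k (n + 1) := by
    rw [Nat.factorial_succ]
    push_cast
    field_simp
  simp [bernoulliEval, gradedScale_of_mem _ hmem, symmetrization_ι_mul_pow, ← hscale, smul_smul]

theorem bernoulliEval_convOp_bernoulliEval (x x' y : g) (n : ℕ) :
    bernoulliEval k g x (convOp (bernoulliEval k g x') (ιS y ^ n)) =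
      (n.factorial : k) • bernoulliBracket k y x' x n := by
  rw [convOp_pow, map_sum, bernoulliBracket, Finset.smul_sum]
  refine Finset.sum_congr rfl fun p hp => ?_
  obtain rfl := Finset.HasAntidiagonal.mem_antidiagonal.1 hp
  rw [map_smul, bernoulliEval_pow, map_smul, smul_mul_assoc, map_smul, bernoulliEval_ι_mul_pow,
    smul_smul, smul_smul, smul_smul, ← Nat.add_choose_mul_factorial_mul_factorial,
    Nat.choose_symm_add]
  congr 1
  push_cast
  ring

theorem bernoulliEval_commutator (x x' : g) :
    bernoulliEval k g x ∘ₗ convOp (bernoulliEval k g x') -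
      bernoulliEval k g x' ∘ₗ convOp (bernoulliEval k g x) = bernoulliEval k g ⁅x, x'⁆ := by
  refine linearMap_ext_pow fun n y => ?_
  rw [LinearMap.sub_apply, LinearMap.comp_apply, LinearMap.comp_apply,
    bernoulliEval_convOp_bernoulliEval, bernoulliEval_convOp_bernoulliEval, ← smul_sub,
    bernoulliBracket_sub_swap, bernoulliEval_pow, smul_smul]

variable (k g) in
/-- The action `x ↦ L_x` of `g` on its symmetric algebra that the symmetrization map turns into the
left multiplication of the enveloping algebra. -/
def leftRep : g →ₗ⁅k⁆ Module.End k S where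
  toLinearMap := convOp ∘ₗ bernoulliEval k g
  map_lie' {x y} := by
    rw [LieRing.of_associative_ring_bracket]
    exact (congrArg convOp (bernoulliEval_commutator x y)).symm.trans (convOp_commutator _ _).symm

theorem leftRep_apply (x : g) : leftRep k g x = convOp (bernoulliEval k g x) := rfl

theorem leftRep_self_pow (y : g) (n : ℕ) : leftRep k g y (ιS y ^ n) = ιS y ^ (n + 1) := by
  have had (p : ℕ) : (LieAlgebra.ad k g y ^ (p + 1)) y = 0 := by simp [pow_succ]
  rw [leftRep_apply, convOp_pow, Finset.sum_eq_single (0, n)]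
  · rw [bernoulliEval_pow]
    simp [bernoulliCoeff, pow_succ']
  · rintro ⟨_ | p, q⟩ hpq hp
    · exact absurd (by simpa using hpq) hp
    · simp [bernoulliEval_pow, had]
  · simp

variable (k g) in
/-- The action of the enveloping algebra on `1` through `leftRep`, which inverts the
symmetrization map. -/
def unsymmetrize : U →ₗ[k] S :=
  LinearMap.applyₗ 1 ∘ₗ (UniversalEnvelopingAlgebra.lift k (leftRep k g)).toLinearMap

theorem unsymmetrize_one : unsymmetrize k g 1 = 1 := by
  simp [unsymmetrize]

theorem unsymmetrize_ι_pow_mul (x : g) (n : ℕ) (u : U) :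
    unsymmetrize k g (ιU x ^ n * u) = (leftRep k g x ^ n) (unsymmetrize k g u) := by
  simp [unsymmetrize]

theorem leftRep_pow_one (y : g) (n : ℕ) : (leftRep k g y ^ n) 1 = ιS y ^ n := by
  induction n with
  | zero => simp
  | succ n ih => rw [pow_succ', Module.End.mul_apply, ih, leftRep_self_pow]

theorem unsymmetrize_symmetrization (s : S) :
    unsymmetrize k g (symmetrization k g s) = s := by
  suffices h : unsymmetrize k g ∘ₗ symmetrization k g = LinearMap.id from LinearMap.congr_fun h s
  refine linearMap_ext_pow fun n y => ?_
  rw [LinearMap.comp_apply, symmetrization_pow, ← mul_one (ιU y ^ n), unsymmetrize_ι_pow_mul,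
    unsymmetrize_one, leftRep_pow_one, LinearMap.id_apply]

variable (k g) in
theorem symmetrization_bijective : Function.Bijective (symmetrization k g) :=
  ⟨Function.LeftInverse.injective unsymmetrize_symmetrization, symmetrization_surjective k g⟩

variable (k g) in
theorem symmetrizationInv_eq_unsymmetrize : symmetrizationInv k g = unsymmetrize k g := by
  ext u
  obtain ⟨s, rfl⟩ := symmetrization_surjective k g u
  rw [unsymmetrize_symmetrization, symmetrizationInv, dif_pos (symmetrization_bijective k g)]
  exact (LinearEquiv.ofBijective _ (symmetrization_bijective k g)).symm_apply_apply s

theorem symmetrization_starProduct (x y : S) :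
    symmetrization k g (starProduct k g x y) = symmetrization k g x * symmetrization k g y := by
  obtain ⟨s, hs⟩ := symmetrization_surjective k g (symmetrization k g x * symmetrization k g y)
  rw [starProduct_apply, symmetrizationInv_eq_unsymmetrize, ← hs, unsymmetrize_symmetrization]

end LeftRepresentation

/-! ### The antipode of the enveloping algebra -/

section Antipode

variable {k g : Type*} [CommRing k] [LieRing g] [LieAlgebra k g]

local notation "U" => UniversalEnvelopingAlgebra k g
local notation "ιU" => UniversalEnvelopingAlgebra.ι k (L := g)

variable (k g) in
/-- The antipode of the enveloping algebra: the anti-automorphism that extends `x ↦ -x`. It is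
encoded as an algebra homomorphism to the opposite algebra, read as a linear map. -/
def antipode : U →ₗ[k] U :=
  (MulOpposite.opLinearEquiv k).symm.toLinearMap ∘ₗ
    (UniversalEnvelopingAlgebra.lift k
      { toLinearMap := -((MulOpposite.opLinearEquiv k).toLinearMap ∘ₗ (ιU : g →ₗ[k] U))
        map_lie' := by simp [LieRing.of_associative_ring_bracket] }).toLinearMap

theorem antipode_mul (u v : U) : antipode k g (u * v) = antipode k g v * antipode k g u := by
  simp [antipode]

theorem antipode_one : antipode k g 1 = 1 := by
  simp [antipode]

theorem antipode_ι (x : g) : antipode k g (ιU x) = -ιU x := by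
  rw [antipode, LinearMap.comp_apply, AlgHom.toLinearMap_apply,
    UniversalEnvelopingAlgebra.lift_ι_apply]
  rfl

theorem antipode_ι_pow (x : g) (n : ℕ) :
    antipode k g (ιU x ^ n) = (-1 : k) ^ n • ιU x ^ n := by
  induction n with
  | zero => simp [antipode_one]
  | succ n ih =>
    rw [pow_succ, antipode_mul, antipode_ι, ih, mul_smul_comm, neg_mul, ← pow_succ', smul_neg,
      ← neg_smul, pow_succ' (-1 : k), neg_one_mul, ← pow_succ]

end Antipode

/-! ### The star product -/

section StarProduct

variable {k g : Type*} [Field k] [CharZero k] [LieRing g] [LieAlgebra k g]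

local notation "S" => SymmetricAlgebra k g
local notation "ιS" => SymmetricAlgebra.ι k g

theorem starProduct_pow (x : g) (n : ℕ) (s : S) :
    starProduct k g (ιS x ^ n) s = (leftRep k g x ^ n) s := by
  rw [starProduct_apply, symmetrizationInv_eq_unsymmetrize, symmetrization_pow,
    unsymmetrize_ι_pow_mul, unsymmetrize_symmetrization]

theorem starComponent_pow (p : ℕ) (x : g) (n : ℕ) :
    starComponent k g p (ιS x ^ n) = coeff p (convOpSeries (bernoulliEval k g x) ^ n) := by
  refine linearMap_ext_pow fun m y => ?_
  rw [starComponent, component_apply _ _ (ι_pow_mem_symPow n x) (ι_pow_mem_symPow m y),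
    starProduct_pow, leftRep_apply,
    ((hasExpansion_convOp _).pow n).coeff_apply p (ι_pow_mem_symPow m y), mul_one, add_comm n m]
  rfl

theorem starComponent_mem_diffOpLT (p : ℕ) (a : S) :
    starComponent k g p a ∈ diffOpLT k S (p + 1) := by
  suffices h : ⊤ ≤ (diffOpLT k S (p + 1)).comap (starComponent k g p) from h Submodule.mem_top
  rw [← span_pow, Submodule.span_le]
  rintro _ ⟨⟨n, x⟩, rfl⟩
  rw [SetLike.mem_coe, Submodule.mem_comap, starComponent_pow]
  exact mem_diffOpSeries.1 (pow_mem (convOpSeries_mem_diffOpSeries _) n) p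

theorem antipode_symmetrization (s : S) :
    antipode k g (symmetrization k g s) = symmetrization k g (gradeInvolution k g s) := by
  suffices h : antipode k g ∘ₗ symmetrization k g = symmetrization k g ∘ₗ gradeInvolution k g from
    LinearMap.congr_fun h s
  refine linearMap_ext_pow fun n y => ?_
  rw [LinearMap.comp_apply, LinearMap.comp_apply, gradeInvolution,
    gradedScale_of_mem _ (ι_pow_mem_symPow n y), map_smul, symmetrization_pow, antipode_ι_pow]

theorem gradeInvolution_starProduct (x y : S) :
    gradeInvolution k g (starProduct k g x y) =
      starProduct k g (gradeInvolution k g y) (gradeInvolution k g x) := by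
  apply (symmetrization_bijective k g).injective
  rw [← antipode_symmetrization, symmetrization_starProduct, symmetrization_starProduct,
    antipode_mul, antipode_symmetrization, antipode_symmetrization]

theorem proj_starProduct_swap {n m p d : ℕ} {x y : S} (hx : x ∈ symPow k g n)
    (hy : y ∈ symPow k g m) (hd : n + m = p + d) :
    GradedAlgebra.proj (symPow k g) d (starProduct k g y x) =
      (-1 : k) ^ p • GradedAlgebra.proj (symPow k g) d (starProduct k g x y) := by
  have hproj : (-1 : k) ^ d • GradedAlgebra.proj (symPow k g) d (starProduct k g x y) =
      (-1 : k) ^ (n + m) • GradedAlgebra.proj (symPow k g) d (starProduct k g y x) := by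
    have h := gradeInvolution_starProduct x y
    rw [gradeInvolution, gradedScale_of_mem _ hx, gradedScale_of_mem _ hy, map_smul, map_smul,
      LinearMap.smul_apply, smul_smul, ← pow_add] at h
    rw [GradedAlgebra.proj_apply, ← decompose_gradedScale, h, ← GradedAlgebra.proj_apply, map_smul]
  have hsq (q : ℕ) : (-1 : k) ^ q * (-1) ^ q = 1 := by rw [← mul_pow, neg_one_mul, neg_neg, one_pow]
  calc GradedAlgebra.proj (symPow k g) d (starProduct k g y x)
      = (-1 : k) ^ (n + m) • (-1 : k) ^ d •
          GradedAlgebra.proj (symPow k g) d (starProduct k g x y) := by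
        rw [hproj, smul_smul, hsq, one_smul]
    _ = (-1 : k) ^ p • GradedAlgebra.proj (symPow k g) d (starProduct k g x y) := by
        rw [smul_smul, hd, pow_add, mul_assoc, hsq, mul_one]

theorem starComponent_flip (p : ℕ) :
    (starComponent k g p).flip = (-1 : k) ^ p • starComponent k g p := by
  refine linearMap_ext_pow fun n x => linearMap_ext_pow fun m y => ?_
  have hx := ι_pow_mem_symPow (k := k) n x
  have hy := ι_pow_mem_symPow (k := k) m y
  rw [LinearMap.flip_apply, LinearMap.smul_apply, LinearMap.smul_apply, starComponent,
    component_apply _ _ hy hx, component_apply _ _ hx hy, add_comm m n]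
  split_ifs with hp
  · exact proj_starProduct_swap hx hy (Nat.add_sub_of_le hp).symm
  · rw [smul_zero]

theorem starComponent_flip_mem_diffOpLT (p : ℕ) (a : S) :
    (starComponent k g p).flip a ∈ diffOpLT k S (p + 1) := by
  rw [starComponent_flip]
  exact Submodule.smul_mem _ _ (starComponent_mem_diffOpLT p a)

end StarProduct

end PBW

end

theorem theorem2p2 (k g : Type*) [Field k] [CharZero k] [LieRing g] [LieAlgebra k g] :
    Function.Bijective (PBW.symmetrization k g) ∧
    ∀ p : ℕ, 1 ≤ p →
      (∀ a : SymmetricAlgebra k g,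
        PBW.IsDifferentialOperator p (PBW.starComponent k g p a) ∧
        PBW.IsDifferentialOperator p ((PBW.starComponent k g p).flip a)) ∧
      PBW.IsBidifferentialOperator p (PBW.starComponent k g p) := by
  have hleft (p : ℕ) (a : SymmetricAlgebra k g) :=
    PBW.isDifferentialOperator_of_mem_diffOpLT (PBW.starComponent_mem_diffOpLT p a)
  have hright (p : ℕ) (a : SymmetricAlgebra k g) :=
    PBW.isDifferentialOperator_of_mem_diffOpLT (PBW.starComponent_flip_mem_diffOpLT p a)
  exact ⟨PBW.symmetrization_bijective k g, fun p _ =>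
    ⟨fun a => ⟨hleft p a, hright p a⟩, hleft p, hright p⟩⟩
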